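/- **The problem.** An instance of the $k$ disjoint bi-constraint path problem ($k$BCP) is a finite directed (multi)graph $G=(V,E)$ with $n=|V|$, $m=|E|$, vertices $s\neq t$, a number $k$ of paths, costs $c:E\to\mathbb R^+$, delays $d:E\to\mathbb R^+$, and bounds $C\in\mathbb Z^+$, $D\in\mathbb R^+$. A solution consists of $k$ pairwise edge-disjoint (simple) $st$-paths with cost sum at most $C$ and delay sum at most $D$. An algorithm is a bifactor $(\alpha,\gamma)$-approximation if on every instance that has a solution it returns, after finitely many steps, $k$ edge-disjoint $st$-paths with delay sum at most $\alpha D$ and cost sum at most $\gamma C$. **The algorithm** (parameters $\beta>0$ and $\varepsilon\ge 0$). Start with $k$ edge-disjoint $st$-paths $P_1,\dots,P_k$ that minimize $\sum_i\sum_{e\in P_i}\bigl(\frac{c(e)}{C}+\frac{d(e)}{D}\bigr)$. Then repeat: 1. If $\sum_i d(P_i)\le(1+\beta)D$, return $P_1,\dots,P_k$. 2. Let $\overline G$ be $G$ with the edges of $P_1,\dots,P_k$ reversed, their delays negated and their costs set to $\varepsilon$. 3. Among the directed (simple) cycles $O$ of $\overline G$ with $d(O)<0$ and with cost at most $C$,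 where for this bound the reversed edges are counted with cost $0$, choose one that minimizes $d(O)/c(O)$, where reversed edges have cost $\varepsilon$ (if $\varepsilon=0$ and $c(O)=0$, this ratio is $-\infty$). 4. Add the edges of $O$ to those of $P_1,\dots,P_k$, remove every pair consisting of an edge and its reversal, and replace $P_1,\dots,P_k$ by $k$ edge-disjoint $st$-paths composed of the remaining edges (left-over edges are discarded). All choices left open (ties, decomposition into paths) may be made arbitrarily. **Corollary.** For $\beta>0$, $1+\ln\frac1\beta=2$ if and only if $\beta=\frac1e$. With $\beta=\frac1e$ the algorithm is a bifactor $\bigl(1+\frac1e,\,2\bigr)$-approximation for $k$BCP, and $1.367<1+\frac1e<1.369$. More precisely: for every instance there is $\varepsilon_0>0$ such that for all $0\le\varepsilon<\varepsilon_0$, if the instance has a solution, then every run of the algorithm with $\beta=\frac1e$ is never stuck, stops after finitely many steps, and returns $k$ edge-disjoint $st$-paths with delay sum at most $(1+\frac1e)D$ and cost sum at most $2C$; if all costs $c(e)$ and the bound $D$ are integers, the same holds for every $0\le\varepsilon<\frac1{mnD}$. -/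

import Mathlib

/-- A directed multigraph with vertex set `V` and edge set `E`. -/
structure DiMultigraph (V E : Type*) where
  src : E → V
  tgt : E → V

namespace DiMultigraph

variable {V E : Type*}

/-- `G.IsWalk u l v`: the edges of the list `l`, in order, form a directed walk from `u` to `v`. -/
def IsWalk (G : DiMultigraph V E) : V → List E → V → Prop
  | u, [], v => u = v
  | u, e :: l, v => G.src e = u ∧ G.IsWalk (G.tgt e) l v

/-- A directed path from `u` to `v` (no vertex is visited twice). -/
def IsPath (G : DiMultigraph V E) (u : V) (l : List E) (v : V) : Prop :=
  G.IsWalk u l v ∧ (u :: l.map G.tgt).Nodup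

/-- A directed cycle: a nonempty closed walk that visits no vertex twice (apart from closing up). -/
def IsCycle (G : DiMultigraph V E) (l : List E) : Prop :=
  l ≠ [] ∧ (∃ v, G.IsWalk v l v) ∧ (l.map G.tgt).Nodup

/-- The graph obtained by reversing the direction of the edges in `F`. -/
def reverse [DecidableEq E] (G : DiMultigraph V E) (F : Finset E) : DiMultigraph V E where
  src e := if e ∈ F then G.tgt e else G.src e
  tgt e := if e ∈ F then G.src e else G.tgt e

end DiMultigraph

/-- An instance of the `k` disjoint bi-constraint path problem. -/
structure KBCP (V E : Type*) where
  G : DiMultigraph V E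
  s : V
  t : V
  s_ne_t : s ≠ t
  /-- the number of paths -/
  k : ℕ
  /-- the edge costs -/
  c : E → ℝ
  c_pos : ∀ e, 0 < c e
  /-- the edge delays -/
  d : E → ℝ
  d_pos : ∀ e, 0 < d e
  /-- the cost bound -/
  C : ℕ
  C_pos : 0 < C
  /-- the delay bound -/
  D : ℝ
  D_pos : 0 < D

/-- An algorithm whose internal choices (ties, for instance) are left open, on states `S`: the
states it may start from, the states at which it returns, and the state changes it may perform
at the other states. -/
structure Procedure (S : Type*) where
  start : S → Prop
  halt : S → Prop
  step : S → S → Prop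

/-- Whatever choices are made, the run from the given state never gets stuck, returns after finitely
many steps, and the state it returns satisfies `good`. -/
inductive Procedure.Ensures {S : Type*} (A : Procedure S) (good : S → Prop) : S → Prop
  | ret {x : S} : A.halt x → good x → Procedure.Ensures A good x
  | next {x : S} : ¬ A.halt x → (∃ y, A.step x y) →
      (∀ y, A.step x y → Procedure.Ensures A good y) → Procedure.Ensures A good x

/-- The procedure can start, and each of its runs returns a state satisfying `good`. -/
def Procedure.Computes {S : Type*} (A : Procedure S) (good : S → Prop) : Prop :=
  (∃ x, A.start x) ∧ ∀ x, A.start x → A.Ensures good x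

namespace KBCP

variable {V E : Type*}

/-- `k` pairwise edge-disjoint `st`-paths. -/
structure DisjointPaths (I : KBCP V E) where
  path : Fin I.k → List E
  isPath : ∀ i, I.G.IsPath I.s (path i) I.t
  disjoint : ∀ i j, i ≠ j → List.Disjoint (path i) (path j)

/-- The sum of the weights `w` of the edges of the `k` paths. -/
def DisjointPaths.weight {I : KBCP V E} (P : I.DisjointPaths) (w : E → ℝ) : ℝ :=
  ∑ i, ((P.path i).map w).sum

/-- The set of the edges of the `k` paths. -/
def DisjointPaths.edges [DecidableEq E] {I : KBCP V E} (P : I.DisjointPaths) : Finset E :=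
  Finset.univ.biUnion fun i => (P.path i).toFinset

/-- The cost sum and the delay sum are at most `β * C` and `α * D`. -/
def DisjointPaths.Within {I : KBCP V E} (P : I.DisjointPaths) (α β : ℝ) : Prop :=
  P.weight I.d ≤ α * I.D ∧ P.weight I.c ≤ β * I.C

/-- The instance has a solution. -/
def Feasible (I : KBCP V E) : Prop := ∃ P : I.DisjointPaths, P.Within 1 1

/-- On the instance `I`, which is assumed to have a solution, the algorithm `A` computes `k` disjoint
`st`-paths of delay sum at most `α * D` and cost sum at most `β * C`. -/
def IsBifactorApproximation (I : KBCP V E) (A : Procedure I.DisjointPaths) (α β : ℝ) : Prop :=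
  I.Feasible → A.Computes fun P => P.Within α β

/-- The mixed edge weight of the basic algorithm. -/
noncomputable def mixed (I : KBCP V E) (e : E) : ℝ := I.c e / I.C + I.d e / I.D

/-- The possible results of the basic algorithm: `k` disjoint paths of minimum mixed weight. -/
def IsBasicOutput (I : KBCP V E) (P : I.DisjointPaths) : Prop :=
  ∀ Q : I.DisjointPaths, P.weight I.mixed ≤ Q.weight I.mixed

section Residual

variable [DecidableEq E]

/-- The cost of an edge after the edges of `P` have been reversed and given cost `ε`. -/
def resCost (I : KBCP V E) (P : I.DisjointPaths) (ε : ℝ) (e : E) : ℝ :=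
  if e ∈ P.edges then ε else I.c e

/-- The delay of an edge after the edges of `P` have been reversed and their delay negated. -/
def resDelay (I : KBCP V E) (P : I.DisjointPaths) (e : E) : ℝ :=
  if e ∈ P.edges then - I.d e else I.d e

/-- The ratio `d(O) / c(O)` of a cycle `O` of negative delay, where reversed edges have cost `ε`;
it is `-∞` when `c(O) = 0` (which can happen only for `ε = 0`). -/
noncomputable def ratio (I : KBCP V E) (P : I.DisjointPaths) (ε : ℝ) (O : List E) : EReal :=
  if (O.map (I.resCost P ε)).sum = 0 then ⊥
  else (((O.map (I.resDelay P)).sum / (O.map (I.resCost P ε)).sum : ℝ) : EReal)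

/-- The cycles among which the improving phase chooses: the cycles of the graph with the edges of `P`
reversed, of negative delay and of cost at most `C`, where for this bound a reversed edge
costs nothing. -/
def IsCandidate (I : KBCP V E) (P : I.DisjointPaths) (O : List E) : Prop :=
  (I.G.reverse P.edges).IsCycle O ∧ (O.map (I.resCost P 0)).sum ≤ I.C ∧
    (O.map (I.resDelay P)).sum < 0

/-- A candidate cycle of minimum ratio. -/
def IsBestCycle (I : KBCP V E) (P : I.DisjointPaths) (ε : ℝ) (O : List E) : Prop :=
  I.IsCandidate P O ∧ ∀ O', I.IsCandidate P O' → I.ratio P ε O ≤ I.ratio P ε O'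

/-- The improved algorithm, based on cycle cancellation. It starts with paths computed by the basic
algorithm and returns as soon as the delay sum is at most `(1 + β) * D`. Otherwise it finds a
best cycle `O`, adds the edges of `O` to the current paths, removes the pairs of an edge and its
reversal, and continues with `k` disjoint paths composed of the remaining edges (what
is left over by the new paths is a union of cycles, and is discarded). -/
noncomputable def improved (I : KBCP V E) (β ε : ℝ) : Procedure I.DisjointPaths where
  start P := I.IsBasicOutput P
  halt P := P.weight I.d ≤ (1 + β) * I.D
  step P Q := ∃ O, I.IsBestCycle P ε O ∧
    Q.edges ⊆ (P.edges \ O.toFinset) ∪ (O.toFinset \ P.edges)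

end Residual

end KBCP

namespace DiMultigraph

variable {V E : Type*}

/-- The edges of `F` carry `k` units of flow from `s` to `t`, expressed by testing the divergence
of `F` against all vertex potentials. -/
def IsFlow (G : DiMultigraph V E) (F : Finset E) (k : ℤ) (s t : V) : Prop :=
  ∀ φ : V → ℤ, ∑ e ∈ F, (φ (G.src e) - φ (G.tgt e)) = k * (φ s - φ t)

theorem IsWalk.sum_potential {G : DiMultigraph V E} (φ : V → ℤ) {l : List E} {u v : V}
    (h : G.IsWalk u l v) : (l.map fun e => φ (G.src e) - φ (G.tgt e)).sum = φ u - φ v := by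
  induction l generalizing u with
  | nil => cases h; simp
  | cons e l ih =>
    obtain ⟨rfl, h⟩ := h
    simp [ih h]

theorem IsWalk.append {G : DiMultigraph V E} {l l' : List E} {u v w : V}
    (h : G.IsWalk u l v) (h' : G.IsWalk v l' w) : G.IsWalk u (l ++ l') w := by
  induction l generalizing u with
  | nil => cases h; exact h'
  | cons e l ih => exact ⟨h.1, ih h.2⟩

theorem IsPath.exists_suffix {G : DiMultigraph V E} {l : List E} {u v w : V}
    (h : G.IsPath w l v) (hu : u ∈ w :: l.map G.tgt) : ∃ l', l' ⊆ l ∧ G.IsPath u l' v := by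
  induction l generalizing w with
  | nil =>
    obtain rfl : u = w := by simpa using hu
    exact ⟨[], by simp, h⟩
  | cons e l ih =>
    rcases List.mem_cons.1 hu with rfl | hu
    · exact ⟨e :: l, List.Subset.refl _, h⟩
    · obtain ⟨l', hl, hp⟩ := ih (w := G.tgt e) ⟨h.1.2, (List.nodup_cons.1 h.2).2⟩ hu
      exact ⟨l', List.subset_cons_of_subset _ hl, hp⟩

theorem IsWalk.exists_isPath {G : DiMultigraph V E} {l : List E} {u v : V}
    (h : G.IsWalk u l v) : ∃ l', l' ⊆ l ∧ G.IsPath u l' v := by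
  induction l generalizing u with
  | nil => exact ⟨[], by simp, h, by simp⟩
  | cons e l ih =>
    obtain ⟨l', hl, hp⟩ := ih h.2
    by_cases hu : u ∈ G.tgt e :: l'.map G.tgt
    · obtain ⟨l'', hl', hp'⟩ := hp.exists_suffix hu
      exact ⟨l'', List.subset_cons_of_subset _ (List.Subset.trans hl' hl), hp'⟩
    · exact ⟨e :: l', List.cons_subset_cons _ hl, ⟨h.1, hp.1⟩, List.nodup_cons.2 ⟨hu, hp.2⟩⟩

theorem IsPath.nodup {G : DiMultigraph V E} {l : List E} {u v : V} (h : G.IsPath u l v) :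
    l.Nodup :=
  (List.nodup_cons.1 h.2).2.of_map _

theorem IsCycle.nodup {G : DiMultigraph V E} {l : List E} (h : G.IsCycle l) : l.Nodup :=
  h.2.2.of_map _

/-- `v` can be reached from `u` along edges of `F`. -/
def Reachable (G : DiMultigraph V E) (F : Finset E) (u v : V) : Prop :=
  ∃ l : List E, G.IsWalk u l v ∧ ∀ e ∈ l, e ∈ F

theorem Reachable.exists_isPath {G : DiMultigraph V E} {F : Finset E} {u v : V}
    (h : G.Reachable F u v) : ∃ l, G.IsPath u l v ∧ ∀ e ∈ l, e ∈ F := by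
  obtain ⟨l, hl, hF⟩ := h
  obtain ⟨l', hs, hp⟩ := hl.exists_isPath
  exact ⟨l', hp, fun e he => hF e (hs he)⟩

open Classical in
theorem reachable_indicator_le (G : DiMultigraph V E) {F : Finset E} (u : V) {e : E}
    (he : e ∈ F) : (if G.Reachable F u (G.src e) then (1 : ℤ) else 0) -
      (if G.Reachable F u (G.tgt e) then 1 else 0) ≤ 0 := by
  by_cases h : G.Reachable F u (G.src e)
  · have h' : G.Reachable F u (G.tgt e) := by
      obtain ⟨l, hl, hF⟩ := h
      refine ⟨l ++ [e], hl.append ⟨rfl, rfl⟩, fun x hx => ?_⟩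
      rcases List.mem_append.1 hx with hx | hx
      · exact hF x hx
      · rwa [List.mem_singleton.1 hx]
    simp [h, h']
  · rw [if_neg h]
    split_ifs <;> simp

theorem IsFlow.reachable {G : DiMultigraph V E} {F : Finset E} {k : ℤ} {s t : V}
    (h : G.IsFlow F k s t) (hk : 0 < k) : G.Reachable F s t := by
  classical
  by_contra ht
  have hs : G.Reachable F s s := ⟨[], rfl, by simp⟩
  have h₁ := h fun v => if G.Reachable F s v then 1 else 0
  have h₂ := Finset.sum_nonpos fun e he => G.reachable_indicator_le (F := F) s (e := e) he
  simp only [hs, ht, if_true, if_false] at h₁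
  linarith

/-- Every edge of a circulation lies on a cycle of the circulation. -/
theorem IsFlow.reachable_of_mem {G : DiMultigraph V E} {F : Finset E} {s t : V}
    (h : G.IsFlow F 0 s t) {e : E} (he : e ∈ F) : G.Reachable F (G.tgt e) (G.src e) := by
  classical
  by_contra ht
  have hs : G.Reachable F (G.tgt e) (G.tgt e) := ⟨[], rfl, by simp⟩
  have h₁ := h fun v => if G.Reachable F (G.tgt e) v then 1 else 0
  rw [zero_mul, Finset.sum_eq_zero_iff_of_nonpos
    fun x hx => G.reachable_indicator_le (F := F) (G.tgt e) hx] at h₁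
  have h₂ := h₁ e he
  simp [hs, ht] at h₂

theorem IsFlow.exists_isCycle {G : DiMultigraph V E} {F : Finset E} {s t : V}
    (h : G.IsFlow F 0 s t) (hF : F.Nonempty) : ∃ l, G.IsCycle l ∧ ∀ e ∈ l, e ∈ F := by
  obtain ⟨e, he⟩ := hF
  obtain ⟨l, hl, hF⟩ := (h.reachable_of_mem he).exists_isPath
  refine ⟨e :: l, ⟨by simp, ⟨G.src e, rfl, hl.1⟩, hl.2⟩, ?_⟩
  simpa [he] using hF

theorem IsWalk.isFlow [DecidableEq E] {G : DiMultigraph V E} {l : List E} {u v : V}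
    (h : G.IsWalk u l v) (hl : l.Nodup) : G.IsFlow l.toFinset 1 u v := fun φ => by
  rw [List.sum_toFinset _ hl, h.sum_potential, one_mul]

theorem IsFlow.sdiff [DecidableEq E] {G : DiMultigraph V E} {F F' : Finset E} {j k : ℤ} {s t : V}
    (h : G.IsFlow F k s t) (h' : G.IsFlow F' j s t) (hs : F' ⊆ F) :
    G.IsFlow (F \ F') (k - j) s t := fun φ => by
  rw [Finset.sum_sdiff_eq_sub hs, h φ, h' φ, sub_mul]

theorem IsCycle.isFlow [DecidableEq E] {G : DiMultigraph V E} {l : List E}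
    (h : G.IsCycle l) (s t : V) : G.IsFlow l.toFinset 0 s t := fun φ => by
  obtain ⟨v, hv⟩ := h.2.1
  rw [hv.isFlow h.nodup φ]
  simp

/-- A nonempty circulation of nonpositive weight contains a cycle of nonpositive weight. -/
theorem IsFlow.exists_isCycle_weight_nonpos [DecidableEq E] {G : DiMultigraph V E} {s t : V}
    (w : E → ℝ) (F : Finset E) (h : G.IsFlow F 0 s t) (hF : F.Nonempty) (hw : ∑ e ∈ F, w e ≤ 0) :
    ∃ l, G.IsCycle l ∧ l.toFinset ⊆ F ∧ ∑ e ∈ l.toFinset, w e ≤ 0 := by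
  induction F using Finset.strongInduction with
  | H F ih =>
    obtain ⟨l, hl, hlF⟩ := h.exists_isCycle hF
    have hsub : l.toFinset ⊆ F := fun e he => hlF e (List.mem_toFinset.1 he)
    by_cases hlw : ∑ e ∈ l.toFinset, w e ≤ 0
    · exact ⟨l, hl, hsub, hlw⟩
    · have hneg : ∑ e ∈ F \ l.toFinset, w e < 0 := by
        rw [Finset.sum_sdiff_eq_sub hsub]
        linarith
      have hne : (F \ l.toFinset).Nonempty := by
        by_contra hemp
        rw [Finset.not_nonempty_iff_eq_empty.1 hemp] at hneg
        simp at hneg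
      obtain ⟨l', hl', hs', hw'⟩ := ih (F \ l.toFinset)
        (Finset.sdiff_ssubset hsub (List.toFinset_nonempty_iff _ |>.2 hl.1))
        (by simpa using h.sdiff (hl.isFlow s t) hsub) hne hneg.le
      exact ⟨l', hl', hs'.trans Finset.sdiff_subset, hw'⟩

theorem IsFlow.exists_disjoint_paths [DecidableEq E] {G : DiMultigraph V E} {s t : V} (k : ℕ)
    {F : Finset E} (h : G.IsFlow F k s t) : ∃ p : Fin k → List E, (∀ i, G.IsPath s (p i) t) ∧
      (∀ i j, i ≠ j → List.Disjoint (p i) (p j)) ∧ ∀ i, ∀ e ∈ p i, e ∈ F := by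
  induction k generalizing F with
  | zero => exact ⟨Fin.elim0, fun i => i.elim0, fun i => i.elim0, fun i => i.elim0⟩
  | succ k ih =>
    obtain ⟨l, hl, hlF⟩ := (h.reachable (by positivity)).exists_isPath
    have hsub : l.toFinset ⊆ F := fun e he => hlF e (List.mem_toFinset.1 he)
    obtain ⟨p, hp, hd, hpF⟩ := ih (F := F \ l.toFinset)
      (by simpa using h.sdiff (hl.1.isFlow hl.nodup) hsub)
    have hlp : ∀ i, List.Disjoint l (p i) := fun i e he he' => by
      simpa [he] using hpF i e he'
    refine ⟨Fin.cons l p, Fin.cases hl hp, ?_, Fin.cases hlF fun i e he =>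
      (Finset.mem_sdiff.1 (hpF i e he)).1⟩
    intro i j
    refine Fin.cases ?_ (fun i => ?_) i <;> refine Fin.cases ?_ (fun j => ?_) j
    · simp
    · exact fun _ => hlp j
    · exact fun _ => (hlp i).symm
    · exact fun hij => hd i j fun h => hij (h ▸ rfl)

end DiMultigraph

theorem Finset.sum_symmDiff_signed {E M : Type*} [DecidableEq E] [AddCommGroup M] (A B : Finset E)
    (f : E → M) :
    ∑ e ∈ symmDiff A B, (if e ∈ A then - f e else f e) = ∑ e ∈ B, f e - ∑ e ∈ A, f e := by
  have h₁ : ∑ e ∈ A \ B, (if e ∈ A then - f e else f e) = - ∑ e ∈ A \ B, f e := by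
    rw [← Finset.sum_neg_distrib]
    exact Finset.sum_congr rfl fun e he => if_pos (Finset.mem_sdiff.1 he).1
  have h₂ : ∑ e ∈ B \ A, (if e ∈ A then - f e else f e) = ∑ e ∈ B \ A, f e :=
    Finset.sum_congr rfl fun e he => if_neg (Finset.mem_sdiff.1 he).2
  have h₃ := Finset.sum_inter_add_sum_sdiff A B f
  have h₄ := Finset.sum_inter_add_sum_sdiff B A f
  rw [symmDiff_def, Finset.sup_eq_union, Finset.sum_union disjoint_sdiff_sdiff, h₁, h₂, ← h₃, ← h₄,
    Finset.inter_comm B A]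
  abel

namespace DiMultigraph

variable {V E : Type*} [DecidableEq E]

theorem sum_reverse_potential (G : DiMultigraph V E) (A F : Finset E) (φ : V → ℤ) :
    ∑ e ∈ F, (φ ((G.reverse A).src e) - φ ((G.reverse A).tgt e)) =
      ∑ e ∈ F, if e ∈ A then - (φ (G.src e) - φ (G.tgt e)) else φ (G.src e) - φ (G.tgt e) := by
  refine Finset.sum_congr rfl fun e _ => ?_
  by_cases he : e ∈ A <;> simp [reverse, he]

/-- The difference of two flows of the same value is a circulation in the residual graph. -/
theorem IsFlow.reverse_symmDiff {G : DiMultigraph V E} {A B : Finset E} {k : ℤ} {s t : V}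
    (hA : G.IsFlow A k s t) (hB : G.IsFlow B k s t) :
    (G.reverse A).IsFlow (symmDiff A B) 0 s t := fun φ => by
  rw [sum_reverse_potential, Finset.sum_symmDiff_signed, hA φ, hB φ]
  ring

/-- Augmenting a flow along a circulation of the residual graph keeps its value. -/
theorem IsFlow.symmDiff_reverse {G : DiMultigraph V E} {A O : Finset E} {k : ℤ} {s t : V}
    (hA : G.IsFlow A k s t) (hO : (G.reverse A).IsFlow O 0 s t) :
    G.IsFlow (symmDiff A O) k s t := fun φ => by
  have h := hO φ
  have h' := Finset.sum_symmDiff_signed A (symmDiff A O) fun e => φ (G.src e) - φ (G.tgt e)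
  rw [symmDiff_symmDiff_cancel_left, ← sum_reverse_potential, h, hA φ] at h'
  linarith

end DiMultigraph

namespace KBCP

variable {V E : Type*}

instance [Finite E] (I : KBCP V E) : Finite I.DisjointPaths := by
  classical
  have := Fintype.ofFinite E
  refine Finite.of_injective
    (fun (P : I.DisjointPaths) (i : Fin I.k) =>
      (⟨P.path i, (P.isPath i).nodup⟩ : {l : List E // l.Nodup})) ?_
  rintro ⟨p, _, _⟩ ⟨q, _, _⟩ h
  obtain rfl : p = q := funext fun i => congrArg Subtype.val (congrFun h i)
  rfl

theorem c_cast_pos (I : KBCP V E) : (0 : ℝ) < I.C := Nat.cast_pos.2 I.C_pos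

theorem exists_cost_gap [Fintype E] (I : KBCP V E) : ∃ ε₀ : ℝ, 0 < ε₀ ∧ ∀ ε < ε₀,
    ∀ P : I.DisjointPaths,
      P.weight I.c < 2 * I.C + ε * Fintype.card E → P.weight I.c ≤ 2 * I.C := by
  have hm : (0 : ℝ) < Fintype.card E + 1 := by positivity
  obtain ⟨δ, hδ, h⟩ : ∃ δ : ℝ, 0 < δ ∧ ∀ P : I.DisjointPaths,
      P.weight I.c < 2 * I.C + δ → P.weight I.c ≤ 2 * I.C := by
    rcases isEmpty_or_nonempty {P : I.DisjointPaths // 2 * I.C < P.weight I.c} with he | he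
    · exact ⟨1, one_pos, fun P _ => not_lt.1 fun hP => he.elim ⟨P, hP⟩⟩
    · obtain ⟨P₀, h₀⟩ := Finite.exists_min
        fun P : {P : I.DisjointPaths // 2 * I.C < P.weight I.c} => P.1.weight I.c
      refine ⟨P₀.1.weight I.c - 2 * I.C, sub_pos.2 P₀.2, fun P hP => not_lt.1 fun hP' => ?_⟩
      have := h₀ ⟨P, hP'⟩
      dsimp only at this
      linarith
  refine ⟨δ / (Fintype.card E + 1), div_pos hδ hm, fun ε hε P hP => h P (hP.trans_le ?_)⟩
  have h₁ := (lt_div_iff₀ hm).1 hε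
  rcases le_or_gt 0 ε with h0 | h0
  · linarith
  · have := mul_nonpos_of_nonpos_of_nonneg h0.le (Nat.cast_nonneg (α := ℝ) (Fintype.card E))
    linarith

variable [DecidableEq E]

theorem DisjointPaths.sum_edges {I : KBCP V E} {M : Type*} [AddCommMonoid M]
    (P : I.DisjointPaths) (w : E → M) :
    ∑ e ∈ P.edges, w e = ∑ i, ((P.path i).map w).sum := by
  rw [DisjointPaths.edges, Finset.sum_biUnion]
  · exact Finset.sum_congr rfl fun i _ => List.sum_toFinset _ (P.isPath i).nodup
  · exact fun i _ j _ hij => List.disjoint_toFinset_iff_disjoint.2 (P.disjoint i j hij)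

theorem DisjointPaths.weight_eq_sum {I : KBCP V E} (P : I.DisjointPaths) (w : E → ℝ) :
    P.weight w = ∑ e ∈ P.edges, w e :=
  (P.sum_edges w).symm

theorem DisjointPaths.weight_mixed {I : KBCP V E} (P : I.DisjointPaths) :
    P.weight I.mixed = P.weight I.c / I.C + P.weight I.d / I.D := by
  simp only [weight_eq_sum, mixed, Finset.sum_add_distrib, Finset.sum_div]

theorem DisjointPaths.isFlow_edges {I : KBCP V E} (P : I.DisjointPaths) :
    I.G.IsFlow P.edges I.k I.s I.t := fun φ => by
  rw [P.sum_edges, Finset.sum_congr rfl fun i _ => (P.isPath i).1.sum_potential φ]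
  simp [mul_sub]

theorem exists_disjointPaths_of_isFlow (I : KBCP V E) {F : Finset E}
    (h : I.G.IsFlow F I.k I.s I.t) : ∃ Q : I.DisjointPaths, Q.edges ⊆ F := by
  obtain ⟨p, hp, hd, hF⟩ := h.exists_disjoint_paths
  refine ⟨⟨p, hp, hd⟩, fun e he => ?_⟩
  obtain ⟨i, -, hi⟩ := Finset.mem_biUnion.1 he
  exact hF i e (List.mem_toFinset.1 hi)

theorem exists_augmentation (I : KBCP V E) (P : I.DisjointPaths) {O : List E}
    (hO : (I.G.reverse P.edges).IsCycle O) :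
    ∃ Q : I.DisjointPaths, Q.edges ⊆ symmDiff P.edges O.toFinset :=
  I.exists_disjointPaths_of_isFlow (P.isFlow_edges.symmDiff_reverse (hO.isFlow _ _))

theorem weight_d_augmentation_le (I : KBCP V E) {P Q : I.DisjointPaths} {O : List E}
    (hO : O.Nodup) (hQ : Q.edges ⊆ symmDiff P.edges O.toFinset) :
    Q.weight I.d ≤ P.weight I.d + (O.map (I.resDelay P)).sum := by
  have h := Finset.sum_symmDiff_signed P.edges (symmDiff P.edges O.toFinset) I.d
  rw [symmDiff_symmDiff_cancel_left] at h
  rw [← List.sum_toFinset _ hO, P.weight_eq_sum, Q.weight_eq_sum]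
  have h' : ∑ e ∈ Q.edges, I.d e ≤ ∑ e ∈ symmDiff P.edges O.toFinset, I.d e :=
    Finset.sum_le_sum_of_subset_of_nonneg hQ fun e _ _ => (I.d_pos e).le
  change _ ≤ _ + ∑ e ∈ O.toFinset, if e ∈ P.edges then - I.d e else I.d e
  linarith

theorem resCost_nonneg (I : KBCP V E) (P : I.DisjointPaths) {ε : ℝ} (hε : 0 ≤ ε) (e : E) :
    0 ≤ I.resCost P ε e := by
  unfold resCost
  split_ifs
  exacts [hε, (I.c_pos e).le]

theorem weight_c_augmentation_le (I : KBCP V E) {P Q : I.DisjointPaths} {O : List E}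
    (hO : O.Nodup) (hQ : Q.edges ⊆ symmDiff P.edges O.toFinset) :
    Q.weight I.c ≤ P.weight I.c + (O.map (I.resCost P 0)).sum := by
  rw [← List.sum_toFinset _ hO, P.weight_eq_sum, Q.weight_eq_sum]
  have h₁ : ∑ e ∈ Q.edges, I.c e ≤ ∑ e ∈ symmDiff P.edges O.toFinset, I.c e :=
    Finset.sum_le_sum_of_subset_of_nonneg hQ fun e _ _ => (I.c_pos e).le
  have h₂ : ∑ e ∈ P.edges \ O.toFinset, I.c e ≤ ∑ e ∈ P.edges, I.c e :=
    Finset.sum_le_sum_of_subset_of_nonneg Finset.sdiff_subset fun e _ _ => (I.c_pos e).le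
  have h₃ : ∑ e ∈ O.toFinset \ P.edges, I.c e ≤ ∑ e ∈ O.toFinset, I.resCost P 0 e := by
    rw [← Finset.sum_congr rfl fun e he =>
      show I.resCost P 0 e = I.c e from if_neg (Finset.mem_sdiff.1 he).2]
    exact Finset.sum_le_sum_of_subset_of_nonneg Finset.sdiff_subset
      fun e _ _ => I.resCost_nonneg P le_rfl e
  rw [symmDiff_def, Finset.sup_eq_union, Finset.sum_union disjoint_sdiff_sdiff] at h₁
  linarith

theorem sum_resCost_symmDiff_le [Fintype E] (I : KBCP V E) (P R : I.DisjointPaths) {ε : ℝ}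
    (hε : 0 ≤ ε) : ∑ e ∈ symmDiff P.edges R.edges, I.resCost P ε e ≤
      R.weight I.c + ε * Fintype.card E := by
  have h₁ : ∑ e ∈ P.edges \ R.edges, I.resCost P ε e ≤ ε * Fintype.card E := by
    rw [Finset.sum_congr rfl fun e he =>
      show I.resCost P ε e = ε from if_pos (Finset.mem_sdiff.1 he).1, Finset.sum_const,
      nsmul_eq_mul, mul_comm]
    exact mul_le_mul_of_nonneg_left (Nat.cast_le.2 (Finset.card_le_univ _)) hε
  have h₂ : ∑ e ∈ R.edges \ P.edges, I.resCost P ε e ≤ R.weight I.c := by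
    rw [Finset.sum_congr rfl fun e he =>
      show I.resCost P ε e = I.c e from if_neg (Finset.mem_sdiff.1 he).2, R.weight_eq_sum]
    exact Finset.sum_le_sum_of_subset_of_nonneg Finset.sdiff_subset fun e _ _ => (I.c_pos e).le
  rw [symmDiff_def, Finset.sup_eq_union, Finset.sum_union disjoint_sdiff_sdiff]
  linarith

/-- If the current paths exceed the delay bound, some candidate cycle has at most the ratio of the
difference to a solution. -/
theorem exists_isCandidate [Fintype E] (I : KBCP V E) (hI : I.Feasible) (P : I.DisjointPaths)
    {ε : ℝ} (hε : 0 ≤ ε) (hP : I.D < P.weight I.d) :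
    ∃ O, I.IsCandidate P O ∧ (O.map (I.resDelay P)).sum * (I.C + ε * Fintype.card E) ≤
      (I.D - P.weight I.d) * (O.map (I.resCost P ε)).sum := by
  obtain ⟨R, hRd, hRc⟩ := hI
  rw [one_mul] at hRd hRc
  have hC := I.c_cast_pos
  have hm : 0 ≤ ε * Fintype.card E := by positivity
  set K : ℝ := I.C + ε * Fintype.card E with hK
  have hd : ∑ e ∈ symmDiff P.edges R.edges, I.resDelay P e = R.weight I.d - P.weight I.d := by
    rw [P.weight_eq_sum, R.weight_eq_sum]
    exact Finset.sum_symmDiff_signed _ _ _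
  have hc := I.sum_resCost_symmDiff_le P R hε
  have hc₀ := I.sum_resCost_symmDiff_le P R le_rfl
  have hne : (symmDiff P.edges R.edges).Nonempty := by
    by_contra h
    rw [Finset.not_nonempty_iff_eq_empty.1 h, Finset.sum_empty] at hd
    linarith
  obtain ⟨O, hO, hOF, hOw⟩ := (P.isFlow_edges.reverse_symmDiff
    R.isFlow_edges).exists_isCycle_weight_nonpos
    (fun e => I.resDelay P e * K - (I.D - P.weight I.d) * I.resCost P ε e) _ hne (by
      rw [Finset.sum_sub_distrib, ← Finset.sum_mul, ← Finset.mul_sum, hd]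
      nlinarith)
  rw [Finset.sum_sub_distrib, ← Finset.sum_mul, ← Finset.mul_sum] at hOw
  have hle : ∑ e ∈ O.toFinset, I.resDelay P e * K ≤
      (I.D - P.weight I.d) * ∑ e ∈ O.toFinset, I.resCost P ε e := by
    rw [← Finset.sum_mul]
    linarith
  refine ⟨O, ⟨hO, ?_, ?_⟩, ?_⟩
  · rw [← List.sum_toFinset _ hO.nodup]
    refine (Finset.sum_le_sum_of_subset_of_nonneg hOF
      fun e _ _ => I.resCost_nonneg P le_rfl e).trans ?_
    linarith
  · rw [← List.sum_toFinset _ hO.nodup]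
    have hnn : ∀ e ∈ O.toFinset, 0 ≤ I.resCost P ε e := fun e _ => I.resCost_nonneg P hε e
    rcases (Finset.sum_nonneg hnn).eq_or_lt with h0 | h0
    · refine Finset.sum_neg (fun e he => ?_) (List.toFinset_nonempty_iff _ |>.2 hO.1)
      have h := (Finset.sum_eq_zero_iff_of_nonneg hnn).1 h0.symm e he
      have heP : e ∈ P.edges := by
        by_contra heP
        rw [resCost, if_neg heP] at h
        exact (I.c_pos e).ne' h
      rw [resDelay, if_pos heP]
      linarith [I.d_pos e]
    · by_contra h
      nlinarith
  · rw [← List.sum_toFinset _ hO.nodup, ← List.sum_toFinset _ hO.nodup]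
    linarith

theorem exists_isBestCycle [Fintype E] (I : KBCP V E) (P : I.DisjointPaths) (ε : ℝ)
    (h : ∃ O, I.IsCandidate P O) : ∃ O, I.IsBestCycle P ε O := by
  have hnodup : Finite {l : List E | l.Nodup} := inferInstanceAs (Finite {l : List E // l.Nodup})
  have hfin : {O | I.IsCandidate P O}.Finite :=
    (Set.toFinite {l : List E | l.Nodup}).subset fun O hO => hO.1.nodup
  obtain ⟨O, hO, hmin⟩ := Set.exists_min_image _ (I.ratio P ε) hfin h
  exact ⟨O, hO, fun O' hO' => hmin O' hO'⟩

/-- A best cycle is cheap compared with the decrease of the delay. -/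
theorem IsBestCycle.cost_mul_le [Fintype E] {I : KBCP V E} (hI : I.Feasible) {P : I.DisjointPaths}
    {ε : ℝ} (hε : 0 ≤ ε) (hP : I.D < P.weight I.d) {O : List E} (hO : I.IsBestCycle P ε O) :
    (O.map (I.resCost P ε)).sum * (P.weight I.d - I.D) ≤
      - (O.map (I.resDelay P)).sum * (I.C + ε * Fintype.card E) := by
  have hC := I.c_cast_pos
  have hm : 0 ≤ ε * Fintype.card E := by positivity
  have hnn : ∀ O : List E, 0 ≤ (O.map (I.resCost P ε)).sum := fun O =>
    List.sum_nonneg fun x hx => by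
      obtain ⟨e, -, rfl⟩ := List.mem_map.1 hx
      exact I.resCost_nonneg P hε e
  by_cases h0 : (O.map (I.resCost P ε)).sum = 0
  · rw [h0, zero_mul]
    exact mul_nonneg (by linarith [hO.1.2.2]) (by linarith)
  obtain ⟨O', hO', hle⟩ := I.exists_isCandidate hI P hε hP
  have hr := hO.2 O' hO'
  rw [ratio, if_neg h0, ratio] at hr
  split_ifs at hr with h0'
  · exact absurd (le_bot_iff.1 hr) (EReal.coe_ne_bot _)
  · rw [EReal.coe_le_coe_iff] at hr
    have hpos := (hnn O).lt_of_ne' h0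
    have hpos' := (hnn O').lt_of_ne' h0'
    have hK : 0 < (I.C : ℝ) + ε * Fintype.card E := by linarith
    have h := hr.trans ((div_le_div_iff₀ hpos' hK).2 hle)
    rw [div_le_div_iff₀ hpos hK] at h
    linarith

/-- The invariant of the improving phase: the cost of paths that are still too long is bounded in
terms of their delay, and paths of small delay have cost at most `2 * C`. -/
def Invariant [Fintype E] (I : KBCP V E) (ε : ℝ) (P : I.DisjointPaths) : Prop :=
  ((1 + 1 / Real.exp 1) * I.D < P.weight I.d → P.weight I.c ≤
    (I.C + ε * Fintype.card E) * Real.log (1 / (P.weight I.d / I.D - 1))) ∧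
  (P.weight I.d ≤ (1 + 1 / Real.exp 1) * I.D → P.weight I.c ≤ 2 * I.C)

theorem IsBasicOutput.invariant [Fintype E] {I : KBCP V E} (hI : I.Feasible) {ε : ℝ}
    (hε : 0 ≤ ε) {P : I.DisjointPaths} (hP : I.IsBasicOutput P) : I.Invariant ε P := by
  obtain ⟨R, hRd, hRc⟩ := hI
  have hC := I.c_cast_pos
  have hD := I.D_pos
  have h := hP R
  rw [P.weight_mixed, R.weight_mixed] at h
  have h₁ : R.weight I.c / I.C ≤ 1 := (div_le_iff₀ hC).2 hRc
  have h₂ : R.weight I.d / I.D ≤ 1 := (div_le_iff₀ hD).2 hRd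
  have hc : 0 ≤ P.weight I.c / I.C := by
    rw [P.weight_eq_sum]
    exact div_nonneg (Finset.sum_nonneg fun e _ => (I.c_pos e).le) hC.le
  have hd : 0 ≤ P.weight I.d / I.D := by
    rw [P.weight_eq_sum]
    exact div_nonneg (Finset.sum_nonneg fun e _ => (I.d_pos e).le) hD.le
  refine ⟨fun hlong => ?_, fun _ => (div_le_iff₀ hC).1 (by linarith)⟩
  have hx : 0 < P.weight I.d / I.D - 1 := by
    have := (lt_div_iff₀ hD).2 hlong
    have : 0 < 1 / Real.exp 1 := by positivity
    linarith
  set x := P.weight I.d / I.D - 1 with hxdef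
  have hlog := Real.log_le_sub_one_of_pos hx
  rw [one_div, Real.log_inv]
  have h₃ : P.weight I.c ≤ (1 - x) * I.C := (div_le_iff₀ hC).1 (by linarith)
  have h₄ : (1 - x) * I.C ≤ - Real.log x * I.C := mul_le_mul_of_nonneg_right (by linarith) hC.le
  have h₅ : 0 ≤ ε * Fintype.card E * - Real.log x := mul_nonneg (by positivity) (by linarith)
  linarith

theorem Invariant.augmentation [Fintype E] {I : KBCP V E} (hI : I.Feasible) {ε : ℝ} (hε : 0 ≤ ε)
    (hgap : ∀ P : I.DisjointPaths,
      P.weight I.c < 2 * I.C + ε * Fintype.card E → P.weight I.c ≤ 2 * I.C)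
    {P Q : I.DisjointPaths} (hP : I.Invariant ε P)
    (hlong : (1 + 1 / Real.exp 1) * I.D < P.weight I.d) {O : List E} (hO : I.IsBestCycle P ε O)
    (hQ : Q.edges ⊆ symmDiff P.edges O.toFinset) : I.Invariant ε Q := by
  have hC := I.c_cast_pos
  have hD := I.D_pos
  have hm : 0 ≤ ε * Fintype.card E := by positivity
  have he : 0 < 1 / Real.exp 1 := by positivity
  have hPc := hP.1 hlong
  have hx := (lt_div_iff₀ hD).2 hlong
  have hx' : 1 / Real.exp 1 < P.weight I.d / I.D - 1 := by linarith
  have hPD : I.D < P.weight I.d := by nlinarith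
  have hQd := I.weight_d_augmentation_le hO.1.1.nodup hQ
  have hQc := I.weight_c_augmentation_le hO.1.1.nodup hQ
  have hcost := hO.cost_mul_le hI hε hPD
  have hmono : (O.map (I.resCost P 0)).sum ≤ (O.map (I.resCost P ε)).sum :=
    List.sum_le_sum fun e _ => by
      unfold resCost
      split_ifs
      exacts [hε, le_rfl]
  have hbound := hO.1.2.1
  set x := P.weight I.d / I.D - 1 with hxdef
  have hx0 : 0 < x := he.trans hx'
  have hPx : P.weight I.d - I.D = x * I.D := by
    rw [hxdef, sub_mul, div_mul_cancel₀ _ hD.ne', one_mul]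
  have hK : 0 < (I.C : ℝ) + ε * Fintype.card E := by linarith
  set K : ℝ := I.C + ε * Fintype.card E with hKdef
  rw [one_div, Real.log_inv] at hPc
  refine ⟨fun hQlong => ?_, fun _ => hgap Q ?_⟩
  · have hy := (lt_div_iff₀ hD).2 hQlong
    set y := Q.weight I.d / I.D - 1 with hydef
    have hy0 : 0 < y := by linarith
    have hQy : Q.weight I.d - I.D = y * I.D := by
      rw [hydef, sub_mul, div_mul_cancel₀ _ hD.ne', one_mul]
    have h₁ : (O.map (I.resCost P ε)).sum ≤ (1 - y / x) * K := by
      have : (O.map (I.resCost P ε)).sum * (x * I.D) ≤ (x - y) * I.D * K := by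
        rw [← hPx]
        exact hcost.trans (mul_le_mul_of_nonneg_right (by linarith) hK.le)
      have h : (O.map (I.resCost P ε)).sum ≤ (x - y) * I.D * K / (x * I.D) :=
        (le_div_iff₀ (by positivity)).2 this
      refine h.trans_eq ?_
      field_simp
    have h₂ : 1 - y / x ≤ Real.log x - Real.log y := by
      have := Real.log_le_sub_one_of_pos (div_pos hy0 hx0)
      rw [Real.log_div hy0.ne' hx0.ne'] at this
      linarith
    have h₃ := mul_le_mul_of_nonneg_right h₂ hK.le
    rw [one_div, Real.log_inv]
    linarith
  · have hlog : - Real.log x < 1 := by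
      have := Real.log_lt_log he hx'
      rw [one_div, Real.log_inv, Real.log_exp] at this
      linarith
    have := mul_lt_mul_of_pos_left hlog hK
    linarith

theorem isBifactorApproximation_improved [Fintype E] (I : KBCP V E) {ε : ℝ} (hε : 0 ≤ ε)
    (hgap : ∀ P : I.DisjointPaths,
      P.weight I.c < 2 * I.C + ε * Fintype.card E → P.weight I.c ≤ 2 * I.C) :
    I.IsBifactorApproximation (I.improved (1 / Real.exp 1) ε) (1 + 1 / Real.exp 1) 2 := by
  intro hI
  constructor
  · have : Nonempty I.DisjointPaths := ⟨hI.choose⟩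
    exact Finite.exists_min fun P : I.DisjointPaths => P.weight I.mixed
  · intro P hP
    replace hP := hP.invariant hI hε
    have hwf : WellFounded fun P Q : I.DisjointPaths => P.weight I.d < Q.weight I.d :=
      have : Std.Irrefl fun P Q : I.DisjointPaths => P.weight I.d < Q.weight I.d :=
        ⟨fun _ => lt_irrefl _⟩
      have : IsTrans I.DisjointPaths fun P Q => P.weight I.d < Q.weight I.d :=
        ⟨fun _ _ _ => lt_trans⟩
      Finite.wellFounded_of_trans_of_irrefl _
    induction P using hwf.induction with
    | _ P ih =>
      by_cases hhalt : P.weight I.d ≤ (1 + 1 / Real.exp 1) * I.D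
      · exact .ret hhalt ⟨hhalt, hP.2 hhalt⟩
      have hlong := not_le.1 hhalt
      refine .next hhalt ?_ ?_
      · have hPD : I.D < P.weight I.d := by
          have : 0 < 1 / Real.exp 1 * I.D := mul_pos (by positivity) I.D_pos
          linarith
        obtain ⟨O₀, hO₀, -⟩ := I.exists_isCandidate hI P hε hPD
        obtain ⟨O, hO⟩ := I.exists_isBestCycle P ε ⟨O₀, hO₀⟩
        obtain ⟨Q, hQ⟩ := I.exists_augmentation P hO.1.1
        exact ⟨Q, O, hO, hQ⟩
      · rintro Q ⟨O, hO, hQ⟩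
        refine ih Q ?_ (hP.augmentation hI hε hgap hlong hO hQ)
        have := I.weight_d_augmentation_le hO.1.1.nodup hQ
        linarith [hO.1.2.2]

theorem cost_gap_of_integral [Fintype V] [Fintype E] (I : KBCP V E)
    (hc : ∀ e, ∃ a : ℕ, I.c e = a) (hD : ∃ a : ℕ, I.D = a) {ε : ℝ} (hε : 0 ≤ ε)
    (h : ε < 1 / (Fintype.card E * Fintype.card V * I.D)) (P : I.DisjointPaths)
    (hP : P.weight I.c < 2 * I.C + ε * Fintype.card E) : P.weight I.c ≤ 2 * I.C := by
  choose a ha using hc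
  obtain ⟨b, hb⟩ := hD
  have hb0 := I.D_pos
  rw [hb, Nat.cast_pos] at hb0
  have hn : 0 < Fintype.card V := Fintype.card_pos_iff.2 ⟨I.s⟩
  have hone : (1 : ℝ) ≤ Fintype.card V * I.D := by
    rw [hb]
    exact_mod_cast Nat.mul_pos hn hb0
  have hden : 0 < (Fintype.card E * Fintype.card V * I.D : ℝ) := one_div_pos.1 (hε.trans_lt h)
  have h₁ : ε * Fintype.card E < 1 := by
    have := (lt_div_iff₀ hden).1 h
    have h₂ := mul_le_mul_of_nonneg_left hone (mul_nonneg hε (Fintype.card E).cast_nonneg)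
    linarith
  have hw : P.weight I.c = (∑ e ∈ P.edges, a e : ℕ) := by
    rw [P.weight_eq_sum, Nat.cast_sum]
    exact Finset.sum_congr rfl fun e _ => ha e
  rw [hw] at hP ⊢
  have h₃ : ((∑ e ∈ P.edges, a e : ℕ) : ℝ) < (2 * I.C + 1 : ℕ) := by
    push_cast at hP ⊢
    linarith
  exact_mod_cast Nat.lt_succ_iff.1 (Nat.cast_lt.1 h₃)

end KBCP

theorem mainTheorem5 {V E : Type*} [Fintype V] [Fintype E] [DecidableEq E] (I : KBCP V E) :
    -- the choice of `β`, and the numerical value of the delay ratio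
    (∀ β : ℝ, 0 < β → (1 + Real.log (1 / β) = 2 ↔ β = 1 / Real.exp 1)) ∧
    (1.367 < 1 + 1 / Real.exp 1 ∧ 1 + 1 / Real.exp 1 < 1.369) ∧
    -- real data: reversed edges have any sufficiently small cost
    (∃ ε₀ : ℝ, 0 < ε₀ ∧ ∀ ε : ℝ, 0 ≤ ε → ε < ε₀ →
      I.IsBifactorApproximation (I.improved (1 / Real.exp 1) ε) (1 + 1 / Real.exp 1) 2) ∧
    -- integral costs and delay bound: reversed edges have any cost below `1 / (m * n * D)`
    ((∀ e, ∃ a : ℕ, I.c e = a) → (∃ a : ℕ, I.D = a) →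
      ∀ ε : ℝ, 0 ≤ ε → ε < 1 / (Fintype.card E * Fintype.card V * I.D) →
        I.IsBifactorApproximation (I.improved (1 / Real.exp 1) ε) (1 + 1 / Real.exp 1) 2) := by
  refine ⟨fun β hβ => ?_, ⟨?_, ?_⟩, ?_, fun hc hD ε hε h =>
    I.isBifactorApproximation_improved hε (I.cost_gap_of_integral hc hD hε h)⟩
  · rw [one_div, Real.log_inv, one_div, ← Real.exp_neg]
    constructor
    · intro h
      rw [← Real.exp_log hβ]
      congr 1
      linarith
    · rintro rfl
      rw [Real.log_exp]
      norm_num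
  · have : (0.367 : ℝ) < 1 / Real.exp 1 := by
      rw [lt_div_iff₀ (Real.exp_pos 1)]
      linarith [Real.exp_one_lt_d9]
    linarith
  · have : 1 / Real.exp 1 < (0.369 : ℝ) := by
      rw [div_lt_iff₀ (Real.exp_pos 1)]
      linarith [Real.exp_one_gt_d9]
    linarith
  · obtain ⟨ε₀, h₀, h⟩ := I.exists_cost_gap
    exact ⟨ε₀, h₀, fun ε hε hlt => I.isBifactorApproximation_improved hε (h ε hlt)⟩
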